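/- Let $1\le N\le\infty$ and $E=\{0,1,\dots,N\}$ ($E=\{0,1,2,\dots\}$ if $N=\infty$). Let $\lambda_n>0$ for $0\le n<N$, $\mu_0=0$, and $\mu_n>0$ for $1\le n\le N$, $n<\infty$. If $N=\infty$, assume that the limits $\lambda=\lim_n\lambda_n>0$ and $\mu=\lim_n\mu_n>0$ exist; if $N<\infty$, put $\lambda_N=0$, $\lambda=\lambda_{N-1}$, $\mu=\mu_N$. Put $\lambda_{-1}=0$. Let $a,b\ge 0$ be locally integrable on $[0,\infty)$ and asymptotically periodic: $a=a_1+a_2$, $b=b_1+b_2$, where $a_1$, $b_1$ are periodic with periods $T_1,T_2>0$ and $a_2(t),b_2(t)\to0$ as $t\to\infty$. Put $a_m=\frac1{T_1}\int_0^{T_1}a_1(u)\,du$ and $b_m=\frac1{T_2}\int_0^{T_2}b_1(u)\,du$, and assume that $a_m>0$ or that $a=0$ almost everywhere on $[0,\infty)$. Let $X(t)$, $t\ge0$, be a birth and death process on $E$ with birth intensities $\lambda_n a(t)$ and death intensities $\mu_n b(t)$, that is, a Markov process whose transition probabilities solve the forward Kolmogorov system (in integrated form), with $\Pr(X(0)=0)>0$.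 Let $\Delta>1$ and suppose that a) $\lambda_{k-1}\mu_{k+1}-\lambda_k\mu_k\ge0$ for $0\le k<N$; b) $\mu b_m-\Delta\lambda a_m>0$; c) $f:=\inf_{0\le k<N}f_k>0$, where $$f_k=\frac{\Delta\lambda\mu_{k+1}-\lambda_{k-1}\mu+\sqrt{(\Delta\lambda\mu_{k+1}-\lambda_{k-1}\mu)^2+4\Delta\lambda\mu(\lambda_{k-1}\mu_{k+1}-\lambda_k\mu_k)}}{2\Delta\lambda\mu}.$$ Let $c\in(0,1)$ satisfy $c<\mu_{k+1}/\mu$ for $0\le k<N$ and $c\le f$. Put $l(t)=c(\mu b(t)-\Delta\lambda a(t))$ and $l=c(\mu b_m-\Delta\lambda a_m)>0$. Call a sequence of positive numbers $(\delta_k)_{1\le k<N}$ admissible if $\liminf_k\delta_k>1$ in the case $N=\infty$ and $$\lambda_k a(t)+\mu_{k+1}b(t)-\delta_{k+1}\lambda_{k+1}a(t)-\delta_k^{-1}\mu_k b(t)\ge l(t)\qquad(0\le k<N,\ t\ge0),$$ where the term with $\delta_k^{-1}$ is absent for $k=0$ and the term with $\delta_{k+1}$ is absent for $k+1=N$. For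 such a sequence let $d_0=1$, $d_k=\delta_1\cdots\delta_k$ for $1\le k<N$, and $q_i=\sum_{m=0}^{i-1}d_m$. Then an admissible sequence exists. Moreover, for every $\varepsilon$ with $0<\varepsilon<l$ there is a constant $K>0$ such that, for every admissible sequence, all $t\ge0$ and all integers $0\le j<N$, $$\Pr\bigl(X(t)\le j\mid X(0)=0\bigr)\ \ge\ 1-q_{j+1}^{-1}\,K\,\lambda_0\,a_m\left(1+\frac{e^{(l-\varepsilon)T_1}}{e^{(l-\varepsilon)T_1}-1}\right).$$ -/

import Mathlib

open MeasureTheory Filter Topology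

namespace BDP

/-- `λ_{k-1}`, with the convention `λ_{-1} = 0`. -/
def prev (lam : ℕ → ℝ) : ℕ → ℝ
  | 0 => 0
  | k + 1 => lam k

/-! ### Rates and basic functions -/

/-- The constant rates of a birth and death process on `E = {0, …, N}`, `1 ≤ N ≤ ∞`, with their
limit values `lamL` (for `λ`) and `muL` (for `μ`): the limits of `λ_n`, `μ_n` if `N = ∞`, and
`λ_{N-1}`, `μ_N` if `N < ∞`. Values of `lam`, `mu` at indices above `N` play no role. -/
structure IsRates (N : ℕ∞) (lam mu : ℕ → ℝ) (lamL muL : ℝ) : Prop where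
  one_le : 1 ≤ N
  lam_pos : ∀ n : ℕ, (n : ℕ∞) < N → 0 < lam n
  mu_pos : ∀ n : ℕ, 1 ≤ n → (n : ℕ∞) ≤ N → 0 < mu n
  mu_zero : mu 0 = 0
  infinite : N = ⊤ → Tendsto lam atTop (𝓝 lamL) ∧ 0 < lamL ∧
    Tendsto mu atTop (𝓝 muL) ∧ 0 < muL
  finite : ∀ n : ℕ, N = ((n + 1 : ℕ) : ℕ∞) →
    lam (n + 1) = 0 ∧ lamL = lam n ∧ muL = mu (n + 1)

/-- `a ≥ 0` is locally integrable on `[0, ∞)` and asymptotically periodic: `a = a₁ + a₂` on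
`[0, ∞)` with `a₁` periodic of period `T > 0` and `a₂ → 0` at infinity. -/
structure IsAsympPeriodic (a a₁ a₂ : ℝ → ℝ) (T : ℝ) : Prop where
  nonneg : ∀ t, 0 ≤ t → 0 ≤ a t
  locInt : LocallyIntegrableOn a (Set.Ici 0)
  period_pos : 0 < T
  decomp : ∀ t, 0 ≤ t → a t = a₁ t + a₂ t
  periodic : ∀ t, 0 ≤ t → a₁ (t + T) = a₁ t
  vanishing : Tendsto a₂ atTop (𝓝 0)

/-- The mean over a period, `(1/T) ∫₀ᵀ a₁`. -/
noncomputable def mean (a₁ : ℝ → ℝ) (T : ℝ) : ℝ := (1 / T) * ∫ u in (0 : ℝ)..T, a₁ u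

/-! ### The birth and death process -/

/-- The intensity of passing from state `i` to state `j` at time `t`. -/
def intensity (birth death : ℕ → ℝ → ℝ) (t : ℝ) (i j : ℕ) : ℝ :=
  if j = i + 1 then birth i t
  else if i = j + 1 then death i t
  else if i = j then -(birth i t + death i t)
  else 0

/-- `p s t i j` (`0 ≤ s ≤ t`, `i, j ∈ E = {0, …, N}`) is the transition function of a
nonhomogeneous birth and death process with birth intensities `birth n t` and death intensities
`death n t`: a stochastic family satisfying the Chapman–Kolmogorov equations and the forward
Kolmogorov system. The intensities are only locally integrable in time, so the
system `d/dt p = p Q(t)` is understood in the usual Carathéodory (integrated) sense. The inner sum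
contains all states `k` from which `j` can be reached by one jump. -/
structure IsTransitionFunction (N : ℕ∞) (birth death : ℕ → ℝ → ℝ)
    (p : ℝ → ℝ → ℕ → ℕ → ℝ) : Prop where
  nonneg : ∀ s t : ℝ, 0 ≤ s → s ≤ t → ∀ i j : ℕ, (i : ℕ∞) ≤ N → 0 ≤ p s t i j
  support : ∀ s t : ℝ, 0 ≤ s → s ≤ t → ∀ i j : ℕ, (i : ℕ∞) ≤ N → N < (j : ℕ∞) → p s t i j = 0
  hasSum_one : ∀ s t : ℝ, 0 ≤ s → s ≤ t → ∀ i : ℕ, (i : ℕ∞) ≤ N → HasSum (p s t i) 1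
  chapman_kolmogorov : ∀ r s t : ℝ, 0 ≤ r → r ≤ s → s ≤ t → ∀ i j : ℕ, (i : ℕ∞) ≤ N →
    HasSum (fun k => p r s i k * p s t k j) (p r t i j)
  continuousOn : ∀ s : ℝ, 0 ≤ s → ∀ i j : ℕ, (i : ℕ∞) ≤ N →
    ContinuousOn (fun t => p s t i j) (Set.Ici s)
  forward : ∀ s t : ℝ, 0 ≤ s → s ≤ t → ∀ i j : ℕ, (i : ℕ∞) ≤ N → (j : ℕ∞) ≤ N →
    p s t i j = (if i = j then 1 else 0) +
      ∫ u in s..t, ∑ k ∈ Finset.range (j + 2), p s u i k * intensity birth death u k j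

/-- `X t`, `t ≥ 0`, is a birth and death process on `E = {0, …, N}` with the given intensities:
a Markov process with a transition function as above. The Markov property says that for every
event `A` of the past up to time `s`,
`P(A, X(s) = i, X(t) = j) = p_{ij}(s, t) P(A, X(s) = i)`. -/
structure IsBirthDeathProcess {Ω : Type*} [MeasurableSpace Ω] (P : Measure Ω) (N : ℕ∞)
    (birth death : ℕ → ℝ → ℝ) (X : ℝ → Ω → ℕ) : Prop where
  measurable : ∀ t : ℝ, 0 ≤ t → Measurable (X t)
  mem_states : ∀ t : ℝ, 0 ≤ t → ∀ ω, (X t ω : ℕ∞) ≤ N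
  markov : ∃ p : ℝ → ℝ → ℕ → ℕ → ℝ, IsTransitionFunction N birth death p ∧
    ∀ s t : ℝ, 0 ≤ s → s ≤ t → ∀ A : Set Ω,
      MeasurableSet[⨆ u ∈ Set.Icc (0 : ℝ) s, MeasurableSpace.comap (X u) ⊤] A →
      ∀ i j : ℕ, (i : ℕ∞) ≤ N → (j : ℕ∞) ≤ N →
        P.real (A ∩ {ω | X s ω = i} ∩ {ω | X t ω = j}) =
          p s t i j * P.real (A ∩ {ω | X s ω = i})

/-! ### Weights and conditions -/

/-- `f_k`, the larger root of
`Δλμ x² - (Δλμ_{k+1} - λ_{k-1}μ) x - (λ_{k-1}μ_{k+1} - λ_kμ_k)`. -/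
noncomputable def fRoot (lam mu : ℕ → ℝ) (lamL muL Δ : ℝ) (k : ℕ) : ℝ :=
  (Δ * lamL * mu (k + 1) - prev lam k * muL +
    Real.sqrt ((Δ * lamL * mu (k + 1) - prev lam k * muL) ^ 2 +
      4 * Δ * lamL * muL * (prev lam k * mu (k + 1) - lam k * mu k))) / (2 * Δ * lamL * muL)

/-- `f = inf_{0 ≤ k < N} f_k`. -/
noncomputable def fInf (N : ℕ∞) (lam mu : ℕ → ℝ) (lamL muL Δ : ℝ) : ℝ :=
  ⨅ k : {k : ℕ // (k : ℕ∞) < N}, fRoot lam mu lamL muL Δ k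

/-- The conditions on the rates, on `Δ > 1` and on `c ∈ (0, 1)`; `am`, `bm` are the mean values
of the two basic functions. -/
structure Conditions (N : ℕ∞) (lam mu : ℕ → ℝ) (lamL muL am bm Δ c : ℝ) : Prop where
  one_lt_Δ : 1 < Δ
  cross : ∀ k : ℕ, (k : ℕ∞) < N → 0 ≤ prev lam k * mu (k + 1) - lam k * mu k
  drift : 0 < muL * bm - Δ * lamL * am
  fInf_pos : 0 < fInf N lam mu lamL muL Δ
  c_pos : 0 < c
  c_lt_one : c < 1
  c_lt_ratio : ∀ k : ℕ, (k : ℕ∞) < N → c < mu (k + 1) / muL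
  c_le_fInf : c ≤ fInf N lam mu lamL muL Δ

/-- `α_k(t) = λ_k(t) + μ_{k+1}(t) - δ_{k+1} λ_{k+1}(t) - δ_k⁻¹ μ_k(t)`. For `k = 0` the last term
vanishes since `μ_0 = 0`; for `k = N - 1 < ∞` the third one does since `λ_N = 0`. -/
noncomputable def alpha (birth death : ℕ → ℝ → ℝ) (δ : ℕ → ℝ) (k : ℕ) (t : ℝ) : ℝ :=
  birth k t + death (k + 1) t - δ (k + 1) * birth (k + 1) t - (δ k)⁻¹ * death k t

/-- Weight sequences `δ_k > 0`, `1 ≤ k < N`, with `liminf δ_k > 1` if `N = ∞` and with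
`inf_{0 ≤ k < N} α_k(t) ≥ l(t)` for all `t ≥ 0`. -/
structure IsWeight (N : ℕ∞) (birth death : ℕ → ℝ → ℝ) (l : ℝ → ℝ) (δ : ℕ → ℝ) : Prop where
  pos : ∀ k : ℕ, 1 ≤ k → (k : ℕ∞) < N → 0 < δ k
  liminf_gt : N = ⊤ → ∃ r : ℝ, 1 < r ∧ ∀ᶠ k in atTop, r ≤ δ k
  le_alpha : ∀ t : ℝ, 0 ≤ t → ∀ k : ℕ, (k : ℕ∞) < N → l t ≤ alpha birth death δ k t

/-- `d_0 = 1`, `d_{k+1} = δ_{k+1} d_k`. -/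
def dWeight (δ : ℕ → ℝ) : ℕ → ℝ
  | 0 => 1
  | k + 1 => δ (k + 1) * dWeight δ k

/-- `q_i = d_0 + … + d_{i-1}`. -/
def qWeight (δ : ℕ → ℝ) (i : ℕ) : ℝ := ∑ m ∈ Finset.range i, dWeight δ m

end BDP

namespace BDP

/-! ### Absolutely continuous functions and an integral form of Gronwall's inequality -/

/-! Write `s_k(t) = P(X(t) ≥ k | X(0) = 0)`. Summing the forward system over the states up to `k`
telescopes to the flux across one edge: `s_{k+1}' = λ_k a (s_k - s_{k+1}) - μ_{k+1} b (s_{k+1} -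
s_{k+2})`. For `V = ∑_{k ≤ m} d_k s_{k+1}`, summation by parts (`sum_dWeight_mul`) turns this into
`V' = λ_0 a - ∑ d_k α_k s_{k+1}` plus boundary terms at `m`, one of which has a favourable sign.
Since `α_k ≥ l(t)`, this gives `V' + l V ≤ λ_0 a + d_m μ_{m+1} b s_{m+2}`, and Gronwall bounds `V`.
As `s_k` decreases in `k`, `q_{j+1} s_{j+1} ≤ V` for `j ≤ m`.

The remaining boundary term disappears. If `N < ∞`, take `m = N - 1`, so that `s_{m+2} = 0`. If `N =
∞`, let `m → ∞`: `s_m` is at most of order `x^m / m!` (`IsSurvival.le_pow_div_factorial`), while an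
admissible sequence is bounded as soon as `a` is positive at one time (`IsWeight.le_of_pos`), so
`d_m` grows at most geometrically.

What is left is `λ_0 ∫₀ᵗ exp(-∫ₓᵗ l) a(x) dx`. It is bounded in `t`, because asymptotic periodicity
makes `∫ₓᵗ l` grow linearly with positive slope up to an additive constant
(`exists_integral_exp_le`). This bound does not involve the weights, hence `K` is uniform in them.
If `a = 0` almost everywhere, then `a_m = 0` and the process stays at `0`.

For existence, `δ_k = (λ_{k-1} + cΔλ) / λ_k` gives the `a`-part of `l(t)` directly; the `b`-part is
a quadratic inequality in `c`, which is what `c ≤ f_k` provides. -/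

theorem _root_.LipschitzOnWith.comp_absolutelyContinuousOnInterval {φ : ℝ → ℝ} {K : NNReal}
    {s : Set ℝ} {f : ℝ → ℝ} {a b : ℝ} (hφ : LipschitzOnWith K φ s)
    (hf : AbsolutelyContinuousOnInterval f a b) (hs : Set.MapsTo f (Set.uIcc a b) s) :
    AbsolutelyContinuousOnInterval (fun x => φ (f x)) a b := by
  rw [absolutelyContinuousOnInterval_iff] at hf ⊢
  intro ε hε
  obtain ⟨d, hd, h⟩ := hf (ε / (K + 1)) (by positivity)
  refine ⟨d, hd, fun E hE hlt => ?_⟩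
  have h1 := h E hE hlt
  have h2 : ∑ i ∈ Finset.range E.1, dist (φ (f (E.2 i).1)) (φ (f (E.2 i).2)) ≤
      K * ∑ i ∈ Finset.range E.1, dist (f (E.2 i).1) (f (E.2 i).2) := by
    rw [Finset.mul_sum]
    refine Finset.sum_le_sum fun i hi => ?_
    have := hE.1 i hi
    exact hφ.dist_le_mul _ (hs this.1) _ (hs this.2)
  have h3 : (0 : ℝ) ≤ ∑ i ∈ Finset.range E.1, dist (f (E.2 i).1) (f (E.2 i).2) :=
    Finset.sum_nonneg fun _ _ => dist_nonneg
  have h4 : (K + 1 : ℝ) * (ε / (K + 1)) = ε := by field_simp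
  have h5 : (0 : ℝ) ≤ K := K.2
  nlinarith

/-- The values of `f` stay in a compact ball, on which a `C¹` function is Lipschitz. -/
theorem _root_.AbsolutelyContinuousOnInterval.comp_of_contDiff {φ f : ℝ → ℝ} {a b : ℝ}
    (hf : AbsolutelyContinuousOnInterval f a b) (hφ : ContDiff ℝ 1 φ) :
    AbsolutelyContinuousOnInterval (fun x => φ (f x)) a b := by
  obtain ⟨C, hC⟩ := hf.exists_bound
  obtain ⟨K, hK⟩ := hφ.contDiffOn.exists_lipschitzOnWith (s := Metric.closedBall 0 C) one_ne_zero
    (convex_closedBall _ _) (isCompact_closedBall _ _)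
  exact hK.comp_absolutelyContinuousOnInterval hf fun x hx => by simpa using hC x hx

theorem ae_hasDerivAt_primitive {f : ℝ → ℝ} {t : ℝ} (hf : IntervalIntegrable f volume 0 t) :
    ∀ᵐ x, x ∈ Set.uIcc 0 t → HasDerivAt (fun y => ∫ u in (0 : ℝ)..y, f u) (f x) x := by
  filter_upwards [hf.ae_hasDerivAt_integral] with x hx h
  exact hx h 0 Set.left_mem_uIcc

theorem absolutelyContinuousOnInterval_primitive {f : ℝ → ℝ} {t : ℝ}
    (hf : IntervalIntegrable f volume 0 t) :
    AbsolutelyContinuousOnInterval (fun y => ∫ u in (0 : ℝ)..y, f u) 0 t :=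
  hf.absolutelyContinuousOnInterval_intervalIntegral Set.left_mem_uIcc

theorem integral_mul_primitive_pow {f : ℝ → ℝ} {t : ℝ} (hf : IntervalIntegrable f volume 0 t)
    (k : ℕ) : ∫ u in (0 : ℝ)..t, f u * (∫ v in (0 : ℝ)..u, f v) ^ k =
      (∫ v in (0 : ℝ)..t, f v) ^ (k + 1) / (k + 1) := by
  have hA := (absolutelyContinuousOnInterval_primitive hf).comp_of_contDiff
    (φ := fun x => x ^ (k + 1) / (k + 1)) (by fun_prop)
  have h := hA.integral_deriv_eq_sub
  simp only [intervalIntegral.integral_same, ne_eq, Nat.add_eq_zero_iff, one_ne_zero, and_false,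
    not_false_eq_true, zero_pow, zero_div, sub_zero] at h
  rw [← h]
  refine intervalIntegral.integral_congr_ae ?_
  filter_upwards [ae_hasDerivAt_primitive hf] with x hx hx'
  have h1 := ((hx (Set.uIoc_subset_uIcc hx')).pow (k + 1)).div_const ((k : ℝ) + 1)
  refine Eq.trans ?_ h1.deriv.symm
  have : (k : ℝ) + 1 ≠ 0 := by positivity
  push_cast
  field_simp

/-- Integrating factor: with `V = ∫ v` and `E` the exponential kernel, `E V` is absolutely
continuous and `(E V)' = E (v + l V) ≤ E g` almost everywhere. Absolute continuity replaces
differentiability since the coefficients are only integrable. No sign of `l` is needed. -/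
theorem primitive_le_of_gronwall {v l g : ℝ → ℝ} {t : ℝ} (ht : 0 ≤ t)
    (hv : IntervalIntegrable v volume 0 t) (hl : IntervalIntegrable l volume 0 t)
    (hg : IntervalIntegrable g volume 0 t)
    (h : ∀ x, 0 ≤ x → x ≤ t → v x + l x * (∫ u in (0 : ℝ)..x, v u) ≤ g x) :
    ∫ u in (0 : ℝ)..t, v u ≤ ∫ x in (0 : ℝ)..t,
      Real.exp (-((∫ u in (0 : ℝ)..t, l u) - ∫ u in (0 : ℝ)..x, l u)) * g x := by
  set E : ℝ → ℝ := fun x => Real.exp (-((∫ u in (0 : ℝ)..t, l u) - ∫ u in (0 : ℝ)..x, l u)) with hE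
  set V : ℝ → ℝ := fun x => ∫ u in (0 : ℝ)..x, v u with hV
  have hVac : AbsolutelyContinuousOnInterval V 0 t := absolutelyContinuousOnInterval_primitive hv
  have hEac : AbsolutelyContinuousOnInterval E 0 t :=
    (absolutelyContinuousOnInterval_primitive hl).comp_of_contDiff
      (φ := fun x => Real.exp (-((∫ u in (0 : ℝ)..t, l u) - x))) (by fun_prop)
  have hprod := hEac.mul hVac
  have hint := hprod.integral_deriv_eq_sub
  have hEt : E t = 1 := by simp [hE]
  have hV0 : V 0 = 0 := by simp [hV]
  simp only [Pi.mul_apply, hEt, hV0, one_mul, mul_zero, sub_zero] at hint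
  change V t ≤ _
  rw [← hint]
  refine intervalIntegral.integral_mono_ae_restrict ht hprod.intervalIntegrable_deriv
    (hg.continuousOn_mul hEac.continuousOn) ?_
  rw [Filter.EventuallyLE, ae_restrict_iff' measurableSet_Icc]
  filter_upwards [ae_hasDerivAt_primitive hv, ae_hasDerivAt_primitive hl] with x h1 h2 hx
  have hx' : x ∈ Set.uIcc 0 t := by rwa [Set.uIcc_of_le ht]
  have hEd : HasDerivAt E (E x * l x) x := by
    have := ((h2 hx').const_sub (∫ u in (0 : ℝ)..t, l u)).neg.exp
    simpa [hE] using this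
  rw [(hEd.mul (h1 hx')).deriv]
  have := mul_le_mul_of_nonneg_left (h x hx.1 hx.2) (Real.exp_pos
    (-((∫ u in (0 : ℝ)..t, l u) - ∫ u in (0 : ℝ)..x, l u))).le
  simp only [hE]
  linarith

theorem intervalIntegrable_of_locallyIntegrableOn {f : ℝ → ℝ}
    (hf : LocallyIntegrableOn f (Set.Ici 0)) {s t : ℝ} (hs : 0 ≤ s) (ht : 0 ≤ t) :
    IntervalIntegrable f volume s t :=
  (hf.integrableOn_compact_subset (fun _ hx => (le_min hs ht).trans hx.1)
    isCompact_uIcc).intervalIntegrable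

/-! ### Exponentially weighted integrals -/

/-- Splitting off the last unit of time gives `I(t) ≤ e^{-κ} I(t - 1) + M`, and `M / (1 - e^{-κ})`
is the fixed point of this recursion. -/
theorem integral_exp_mul_le {f : ℝ → ℝ} {κ M : ℝ} (hκ : 0 < κ) (hf0 : ∀ t, 0 ≤ t → 0 ≤ f t)
    (hf : ∀ s t, 0 ≤ s → 0 ≤ t → IntervalIntegrable f volume s t)
    (hM : ∀ s t, 0 ≤ s → s ≤ t → t ≤ s + 1 → ∫ u in s..t, f u ≤ M) {t : ℝ} (ht : 0 ≤ t) :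
    ∫ u in (0 : ℝ)..t, Real.exp (-(κ * (t - u))) * f u ≤ M / (1 - Real.exp (-κ)) := by
  have hM0 : 0 ≤ M := by simpa using hM 0 0 le_rfl le_rfl (by norm_num)
  have he : Real.exp (-κ) < 1 := by simpa using hκ
  have he0 := Real.exp_pos (-κ)
  have hint : ∀ t s r : ℝ, 0 ≤ s → 0 ≤ r →
      IntervalIntegrable (fun u => Real.exp (-(κ * (t - u))) * f u) volume s r :=
    fun t s r hs hr => (hf s r hs hr).continuousOn_mul (by fun_prop)
  have hshort : ∀ s t : ℝ, 0 ≤ s → s ≤ t → t ≤ s + 1 →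
      ∫ u in s..t, Real.exp (-(κ * (t - u))) * f u ≤ M := fun s t hs hst hts =>
    (intervalIntegral.integral_mono_on hst (hint t s t hs (hs.trans hst))
      (hf s t hs (hs.trans hst)) fun u hu => by
        have : Real.exp (-(κ * (t - u))) ≤ 1 := by
          rw [Real.exp_le_one_iff]
          nlinarith [hu.2]
        nlinarith [hf0 u (hs.trans hu.1)]).trans (hM s t hs hst hts)
  have hMle : M ≤ M / (1 - Real.exp (-κ)) := by
    rw [le_div_iff₀ (by linarith)]
    nlinarith
  obtain ⟨n, hn⟩ := exists_nat_ge t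
  induction n generalizing t with
  | zero =>
    have : t = 0 := le_antisymm (by simpa using hn) ht
    subst this
    simpa using hM0.trans hMle
  | succ n ih =>
    rcases le_total t 1 with h1 | h1
    · exact (hshort 0 t le_rfl ht (by simpa using h1)).trans hMle
    have ht1 : 0 ≤ t - 1 := by linarith
    have ih' := ih ht1 (by push_cast at hn; linarith)
    rw [← intervalIntegral.integral_add_adjacent_intervals (hint t 0 (t - 1) le_rfl ht1)
      (hint t (t - 1) t ht1 ht)]
    have h2 := hshort (t - 1) t ht1 (by linarith) (by linarith)
    have h3 : ∫ u in (0 : ℝ)..(t - 1), Real.exp (-(κ * (t - u))) * f u =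
        Real.exp (-κ) * ∫ u in (0 : ℝ)..(t - 1), Real.exp (-(κ * (t - 1 - u))) * f u := by
      rw [← intervalIntegral.integral_const_mul]
      congr 1
      ext u
      rw [← mul_assoc, ← Real.exp_add]
      ring_nf
    rw [h3]
    have h4 := mul_le_mul_of_nonneg_left ih' he0.le
    have h5 : M / (1 - Real.exp (-κ)) = Real.exp (-κ) * (M / (1 - Real.exp (-κ))) + M := by
      have : 1 - Real.exp (-κ) ≠ 0 := by linarith
      field_simp
      ring
    linarith

/-! ### Asymptotically periodic functions -/

namespace IsAsympPeriodic

variable {a a₁ a₂ : ℝ → ℝ} {T : ℝ}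

theorem intervalIntegrable (h : IsAsympPeriodic a a₁ a₂ T) {s t : ℝ} (hs : 0 ≤ s) (ht : 0 ≤ t) :
    IntervalIntegrable a volume s t :=
  intervalIntegrable_of_locallyIntegrableOn h.locInt hs ht

theorem periodic_nat (h : IsAsympPeriodic a a₁ a₂ T) (n : ℕ) {t : ℝ} (ht : 0 ≤ t) :
    a₁ (t + n * T) = a₁ t := by
  induction n with
  | zero => simp
  | succ n ih =>
    have hT := h.period_pos
    rw [← ih, ← h.periodic (t + n * T) (by positivity)]
    push_cast
    ring_nf

theorem tendsto_shift (h : IsAsympPeriodic a a₁ a₂ T) (t : ℝ) :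
    Tendsto (fun n : ℕ => t + n * T) atTop atTop :=
  tendsto_atTop_add_const_left _ _ (tendsto_natCast_atTop_atTop.atTop_mul_const h.period_pos)

theorem tendsto_periodic (h : IsAsympPeriodic a a₁ a₂ T) {t : ℝ} (ht : 0 ≤ t) :
    Tendsto (fun n : ℕ => a (t + n * T)) atTop (𝓝 (a₁ t)) := by
  have hT := h.period_pos
  have h1 : Tendsto (fun n : ℕ => a₁ t + a₂ (t + n * T)) atTop (𝓝 (a₁ t + 0)) :=
    (h.vanishing.comp (h.tendsto_shift t)).const_add _
  rw [add_zero] at h1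
  refine h1.congr fun n => ?_
  rw [h.decomp _ (by positivity), h.periodic_nat n ht]

/-- Measurability of `a₁` is not assumed; it follows because `a₁` is the pointwise limit of the
shifts `a (· + nT)`. One shift far enough out, where `|a₂| ≤ 1`, serves as dominating function. -/
theorem intervalIntegrable_periodic (h : IsAsympPeriodic a a₁ a₂ T) {t : ℝ} (ht : 0 ≤ t) :
    IntervalIntegrable a₁ volume 0 t := by
  have hT := h.period_pos
  have hshift : ∀ n : ℕ, IntervalIntegrable (fun u => a (u + n * T)) volume 0 t := fun n => by
    have := (h.intervalIntegrable (s := n * T) (t := t + n * T) (by positivity)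
      (by positivity)).comp_add_right (n * T)
    simpa using this
  have hmeas : AEStronglyMeasurable a₁ (volume.restrict (Set.Ioc 0 t)) := by
    refine aestronglyMeasurable_of_tendsto_ae atTop (f := fun (n : ℕ) u => a (u + n * T))
      (fun n => (hshift n).1.aestronglyMeasurable) ?_
    filter_upwards [ae_restrict_mem measurableSet_Ioc] with u hu
    exact h.tendsto_periodic hu.1.le
  obtain ⟨R, hR⟩ := eventually_atTop.1
    (h.vanishing.eventually (Metric.closedBall_mem_nhds (0 : ℝ) one_pos))
  obtain ⟨n, hn⟩ := ((h.tendsto_shift 0).eventually_ge_atTop R).exists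
  have hb : IntervalIntegrable (fun u => |a (u + n * T)| + 1) volume 0 t :=
    (hshift n).abs.add intervalIntegrable_const
  refine hb.mono_fun (by rwa [Set.uIoc_of_le ht]) ?_
  rw [Set.uIoc_of_le ht]
  filter_upwards [ae_restrict_mem measurableSet_Ioc] with u hu
  have h1 := h.decomp (u + n * T) (by have := hu.1; positivity)
  rw [h.periodic_nat n hu.1.le] at h1
  have h2 := hR (u + n * T) (by linarith [hu.1])
  simp only [dist_zero_right, Real.norm_eq_abs] at h2
  have h3 : a₁ u = a (u + n * T) - a₂ (u + n * T) := by linarith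
  rw [Real.norm_eq_abs, Real.norm_eq_abs, h3, abs_of_nonneg (a := |a (u + n * T)| + 1)
    (by positivity)]
  exact (abs_sub _ _).trans (by linarith)

/-- The difference is continuous and `T`-periodic in `t`, so its bound on `[0, T]` is global. -/
theorem abs_integral_periodic_sub_le (h : IsAsympPeriodic a a₁ a₂ T) :
    ∃ C, ∀ t, 0 ≤ t → |(∫ u in (0 : ℝ)..t, a₁ u) - mean a₁ T * t| ≤ C := by
  have hT := h.period_pos
  have hstep : ∀ t, 0 ≤ t → (∫ u in (0 : ℝ)..(t + T), a₁ u) - mean a₁ T * (t + T) =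
      (∫ u in (0 : ℝ)..t, a₁ u) - mean a₁ T * t := fun t ht => by
    have h1 : ∫ u in T..(t + T), a₁ u = ∫ u in (0 : ℝ)..t, a₁ u := by
      have h2 := intervalIntegral.integral_comp_add_right (a := 0) (b := t) a₁ T
      rw [zero_add] at h2
      rw [← h2]
      refine intervalIntegral.integral_congr fun u hu => h.periodic u ?_
      rw [Set.uIcc_of_le ht] at hu
      exact hu.1
    have hi1 := h.intervalIntegrable_periodic hT.le
    have hi2 := h.intervalIntegrable_periodic (t := t + T) (by positivity)
    have h2 := intervalIntegral.integral_add_adjacent_intervals hi1 (hi1.symm.trans hi2)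
    have h3 : mean a₁ T * T = ∫ u in (0 : ℝ)..T, a₁ u := by
      rw [mean]
      field_simp
    rw [← h2, h1]
    linarith
  have hcont : ContinuousOn (fun t => (∫ u in (0 : ℝ)..t, a₁ u) - mean a₁ T * t) (Set.Icc 0 T) := by
    have h1 := (absolutelyContinuousOnInterval_primitive
      (h.intervalIntegrable_periodic hT.le)).continuousOn
    rw [Set.uIcc_of_le hT.le] at h1
    exact h1.sub (by fun_prop)
  obtain ⟨C, hC⟩ := isCompact_Icc.exists_bound_of_continuousOn hcont
  refine ⟨C, fun t ht => ?_⟩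
  obtain ⟨n, hn⟩ := exists_nat_ge (t / T)
  rw [div_le_iff₀ hT] at hn
  induction n generalizing t with
  | zero => exact hC t ⟨ht, by simp at hn; linarith⟩
  | succ n ih =>
    rcases le_total t T with h1 | h1
    · exact hC t ⟨ht, h1⟩
    have := ih (t - T) (by linarith) (by push_cast at hn; linarith)
    rwa [← hstep (t - T) (by linarith), sub_add_cancel] at this

theorem abs_integral_sub_le (h : IsAsympPeriodic a a₁ a₂ T) {ε : ℝ} (hε : 0 < ε) :
    ∃ C, ∀ s t, 0 ≤ s → s ≤ t →
      |(∫ u in s..t, a u) - mean a₁ T * (t - s)| ≤ ε * (t - s) + C := by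
  obtain ⟨C, hC⟩ := h.abs_integral_periodic_sub_le
  obtain ⟨R, hR⟩ := eventually_atTop.1
    (h.vanishing.eventually (Metric.closedBall_mem_nhds (0 : ℝ) hε))
  set R' := max R 0
  have hi : ∀ s t, 0 ≤ s → 0 ≤ t → IntervalIntegrable a₁ volume s t := fun s t hs ht =>
    (h.intervalIntegrable_periodic hs).symm.trans (h.intervalIntegrable_periodic ht)
  have hd : ∀ s t, 0 ≤ s → 0 ≤ t → IntervalIntegrable (fun u => |a u - a₁ u|) volume s t :=
    fun s t hs ht => ((h.intervalIntegrable hs ht).sub (hi s t hs ht)).abs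
  have hind : ∀ s t, 0 ≤ s → s ≤ t →
      ∫ u in s..t, |a u - a₁ u| ≤ ε * (t - s) + ∫ u in (0 : ℝ)..R', |a u - a₁ u| := by
    intro s t hs hst
    have hR'0 : 0 ≤ R' := le_max_right _ _
    have hfar : ∀ s t, R' ≤ s → s ≤ t → ∫ u in s..t, |a u - a₁ u| ≤ ε * (t - s) := by
      intro s t hs hst
      have h0 : 0 ≤ s := hR'0.trans hs
      calc ∫ u in s..t, |a u - a₁ u| ≤ ∫ u in s..t, ε :=
            intervalIntegral.integral_mono_on hst (hd s t h0 (h0.trans hst))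
              intervalIntegrable_const fun u hu => by
                have h1 := hR u ((le_max_left _ _).trans (hs.trans hu.1))
                rw [h.decomp u (h0.trans hu.1), add_sub_cancel_left]
                simpa using h1
        _ = ε * (t - s) := by simp [mul_comm]
    have hnn : ∀ s t : ℝ, s ≤ t → 0 ≤ ∫ u in s..t, |a u - a₁ u| := fun s t hst =>
      intervalIntegral.integral_nonneg hst fun _ _ => abs_nonneg _
    have ht : 0 ≤ t := hs.trans hst
    rcases le_total R' s with h1 | h1
    · linarith [hfar s t h1 hst, hnn 0 R' hR'0]
    have h2 := intervalIntegral.integral_add_adjacent_intervals (hd 0 s le_rfl hs)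
      (hd s R' hs hR'0)
    have hts : 0 ≤ ε * (t - s) := mul_nonneg hε.le (by linarith)
    rcases le_total R' t with h3 | h3
    · have h4 := intervalIntegral.integral_add_adjacent_intervals (hd s R' hs hR'0)
        (hd R' t hR'0 ht)
      have h5 := hfar R' t le_rfl h3
      have h6 : ε * (t - R') ≤ ε * (t - s) := mul_le_mul_of_nonneg_left (by linarith) hε.le
      linarith [hnn 0 s hs]
    · have h4 := intervalIntegral.integral_add_adjacent_intervals (hd s t hs ht)
        (hd t R' ht hR'0)
      linarith [hnn 0 s hs, hnn t R' h3]
  -- One `C` for each endpoint of the periodic part; the integral up to `R'` covers the times at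
  -- which `a₂` is not yet below `ε`.
  refine ⟨2 * C + ∫ u in (0 : ℝ)..R', |a u - a₁ u|, fun s t hs hst => ?_⟩
  have ht : 0 ≤ t := hs.trans hst
  have h1 : ∫ u in s..t, a u = (∫ u in s..t, a₁ u) + ∫ u in s..t, (a u - a₁ u) := by
    rw [intervalIntegral.integral_sub (h.intervalIntegrable hs ht) (hi s t hs ht)]
    ring
  have h2 := (intervalIntegral.abs_integral_le_integral_abs (f := fun u => a u - a₁ u)
    (μ := volume) hst).trans (hind s t hs hst)
  have h3 := intervalIntegral.integral_add_adjacent_intervals (hi 0 s le_rfl hs) (hi s t hs ht)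
  have h4 := abs_le.1 (hC s hs)
  have h5 := abs_le.1 (hC t ht)
  have h6 := abs_le.1 h2
  rw [h1, abs_le]
  constructor <;> linarith [h6.1, h6.2, h5.1, h5.2, h4.1, h4.2]

theorem mean_eq_zero (h : IsAsympPeriodic a a₁ a₂ T)
    (h0 : ∀ᵐ t ∂(volume.restrict (Set.Ici (0 : ℝ))), a t = 0) : mean a₁ T = 0 := by
  have hT := h.period_pos
  have hI : ∀ t, 0 ≤ t → ∫ u in (0 : ℝ)..t, a u = 0 := fun t ht => by
    rw [intervalIntegral.integral_of_le ht]
    refine integral_eq_zero_of_ae (ae_restrict_of_ae_restrict_of_subset ?_ h0)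
    exact fun u hu => hu.1.le
  by_contra hne
  have hpos : 0 < |mean a₁ T| := abs_pos.2 hne
  obtain ⟨C, hC⟩ := h.abs_integral_sub_le (ε := |mean a₁ T| / 2) (by positivity)
  have hC0 : 0 ≤ C := by simpa using hC 0 0 le_rfl le_rfl
  -- At this time the estimate would read `2 (C + 1) ≤ (C + 1) + C`.
  have h1 := hC 0 (2 * (C + 1) / |mean a₁ T|) le_rfl (by positivity)
  rw [hI _ (by positivity), zero_sub, sub_zero, abs_neg, abs_mul,
    abs_of_nonneg (a := 2 * (C + 1) / |mean a₁ T|) (by positivity)] at h1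
  have h2 : |mean a₁ T| * (2 * (C + 1) / |mean a₁ T|) = 2 * (C + 1) := by field_simp
  nlinarith

end IsAsympPeriodic

/-! ### Survival functions -/

theorem intervalIntegrable_sum {ι : Type*} (S : Finset ι) {f : ι → ℝ → ℝ} {s t : ℝ}
    (h : ∀ i ∈ S, IntervalIntegrable (f i) volume s t) :
    IntervalIntegrable (fun u => ∑ i ∈ S, f i u) volume s t := by
  rw [← Finset.sum_fn]
  exact IntervalIntegrable.sum S h

/-- `P(X(t) ≥ k | X(0) = 0)` in terms of the transition function. -/
def survival (p : ℝ → ℝ → ℕ → ℕ → ℝ) (k : ℕ) (t : ℝ) : ℝ :=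
  1 - ∑ i ∈ Finset.range k, p 0 t 0 i

/-- The properties of `s k t = P(X(t) ≥ k | X(0) = 0)` which follow from the forward system. -/
structure IsSurvival (N : ℕ∞) (lam mu : ℕ → ℝ) (a b : ℝ → ℝ) (s : ℕ → ℝ → ℝ) : Prop where
  zero : ∀ t, 0 ≤ t → s 0 t = 1
  nonneg : ∀ k t, 0 ≤ t → 0 ≤ s k t
  anti : ∀ k t, 0 ≤ t → s (k + 1) t ≤ s k t
  top : ∀ k : ℕ, N < (k : ℕ∞) → ∀ t, 0 ≤ t → s k t = 0
  continuousOn : ∀ k, ContinuousOn (s k) (Set.Ici 0)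
  integral_eq : ∀ k : ℕ, (k : ℕ∞) < N → ∀ t, 0 ≤ t → s (k + 1) t = ∫ u in (0 : ℝ)..t,
    (lam k * a u * (s k u - s (k + 1) u) - mu (k + 1) * b u * (s (k + 1) u - s (k + 2) u))

/-- Mass leaves or enters `{0, …, k}` only across the edge between `k` and `k + 1`; all other flows
cancel. -/
theorem sum_forward (birth death : ℕ → ℝ → ℝ) (p : ℕ → ℝ) (t : ℝ) (h0 : death 0 t = 0) (k : ℕ) :
    ∑ i ∈ Finset.range (k + 1), ∑ m ∈ Finset.range (i + 2), p m * intensity birth death t m i =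
      death (k + 1) t * p (k + 1) - birth k t * p k := by
  induction k with
  | zero =>
    simp [Finset.sum_range_succ, intensity, h0]
    ring
  | succ k ih =>
    rw [Finset.sum_range_succ, ih, Finset.sum_range_succ, Finset.sum_range_succ,
      Finset.sum_range_succ, Finset.sum_eq_zero]
    · simp [intensity]
      ring
    · intro m hm
      rw [Finset.mem_range] at hm
      rw [intensity, if_neg (by omega), if_neg (by omega), if_neg (by omega), mul_zero]

theorem IsTransitionFunction.isSurvival {N : ℕ∞} {lam mu : ℕ → ℝ} {a b : ℝ → ℝ}
    {p : ℝ → ℝ → ℕ → ℕ → ℝ} (hmu : mu 0 = 0)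
    (hp : IsTransitionFunction N (fun n t => lam n * a t) (fun n t => mu n * b t) p)
    (ha : ∀ t, 0 ≤ t → IntervalIntegrable a volume 0 t)
    (hb : ∀ t, 0 ≤ t → IntervalIntegrable b volume 0 t) :
    IsSurvival N lam mu a b (survival p) where
  zero t ht := by simp [survival]
  nonneg k t ht := by
    have := sum_le_hasSum (Finset.range k) (fun i _ => hp.nonneg 0 t le_rfl ht 0 i (by simp))
      (hp.hasSum_one 0 t le_rfl ht 0 (by simp))
    rw [survival]
    linarith
  anti k t ht := by
    have := hp.nonneg 0 t le_rfl ht 0 k (by simp)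
    simp only [survival, Finset.sum_range_succ]
    linarith
  top k hk t ht := by
    have h1 := hp.hasSum_one 0 t le_rfl ht 0 (by simp)
    have h2 : HasSum (p 0 t 0) (∑ i ∈ Finset.range k, p 0 t 0 i) :=
      hasSum_sum_of_ne_finset_zero fun i hi => by
        refine hp.support 0 t le_rfl ht 0 i (by simp) (hk.trans_le ?_)
        rw [Finset.mem_range, not_lt] at hi
        exact_mod_cast hi
    rw [survival, h1.unique h2, sub_self]
  continuousOn k := by
    unfold survival
    exact continuousOn_const.sub (continuousOn_finsetSum _ fun i _ =>
      hp.continuousOn 0 le_rfl 0 i (by simp))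
  integral_eq k hk t ht := by
    have hint : ∀ m i : ℕ, IntervalIntegrable (fun u => p 0 u 0 m *
        intensity (fun n t => lam n * a t) (fun n t => mu n * b t) u m i) volume 0 t := by
      intro m i
      refine IntervalIntegrable.continuousOn_mul ?_ ((hp.continuousOn 0 le_rfl 0 m (by simp)).mono
        fun x hx => by rw [Set.uIcc_of_le ht] at hx; exact hx.1)
      simp only [intensity]
      split_ifs
      · exact (ha t ht).const_mul _
      · exact (hb t ht).const_mul _
      · exact (((ha t ht).const_mul _).add ((hb t ht).const_mul _)).neg
      · exact intervalIntegrable_const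
    have hF : ∀ i ∈ Finset.range (k + 1), p 0 t 0 i = (if 0 = i then 1 else 0) +
        ∫ u in (0 : ℝ)..t, ∑ m ∈ Finset.range (i + 2), p 0 u 0 m *
          intensity (fun n t => lam n * a t) (fun n t => mu n * b t) u m i := fun i hi =>
      hp.forward 0 t le_rfl ht 0 i (by simp) (le_trans (by
        rw [Finset.mem_range] at hi
        exact_mod_cast Nat.lt_succ_iff.1 hi) hk.le)
    rw [survival, Finset.sum_congr rfl hF, Finset.sum_add_distrib,
      ← intervalIntegral.integral_finsetSum fun i _ =>
        intervalIntegrable_sum _ fun m _ => hint m i]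
    simp_rw [fun u => sum_forward (fun n t => lam n * a t) (fun n t => mu n * b t) (p 0 u 0) u
      (show mu 0 * b u = 0 by rw [hmu, zero_mul])]
    rw [Finset.sum_ite_eq, if_pos (by simp), sub_add_cancel_left, ← intervalIntegral.integral_neg]
    congr 1
    ext u
    simp only [survival, Finset.sum_range_succ]
    ring

namespace IsSurvival

variable {N : ℕ∞} {lam mu : ℕ → ℝ} {a b : ℝ → ℝ} {s : ℕ → ℝ → ℝ}

theorem antitone (h : IsSurvival N lam mu a b s) {t : ℝ} (ht : 0 ≤ t) :
    Antitone fun k => s k t :=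
  antitone_nat_of_succ_le fun k => h.anti k t ht

theorem continuousOn_uIcc (h : IsSurvival N lam mu a b s) (k : ℕ) {t : ℝ} (ht : 0 ≤ t) :
    ContinuousOn (s k) (Set.uIcc 0 t) :=
  (h.continuousOn k).mono fun x hx => by rw [Set.uIcc_of_le ht] at hx; exact hx.1

theorem intervalIntegrable (h : IsSurvival N lam mu a b s)
    (hai : ∀ t, 0 ≤ t → IntervalIntegrable a volume 0 t)
    (hbi : ∀ t, 0 ≤ t → IntervalIntegrable b volume 0 t) (k : ℕ) {t : ℝ} (ht : 0 ≤ t) :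
    IntervalIntegrable (fun u => lam k * a u * (s k u - s (k + 1) u) -
      mu (k + 1) * b u * (s (k + 1) u - s (k + 2) u)) volume 0 t :=
  (((hai t ht).const_mul _).mul_continuousOn
    ((h.continuousOn_uIcc k ht).sub (h.continuousOn_uIcc (k + 1) ht))).sub
    (((hbi t ht).const_mul _).mul_continuousOn
    ((h.continuousOn_uIcc (k + 1) ht).sub (h.continuousOn_uIcc (k + 2) ht)))

/-- Dropping deaths leaves `s_{k+1}' ≤ Λ a s_k`, which is iterated from `s_0 = 1`. -/
theorem le_pow_div_factorial (h : IsSurvival N lam mu a b s)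
    (hlam : ∀ k : ℕ, (k : ℕ∞) < N → 0 ≤ lam k)
    (hmu : ∀ k : ℕ, (k : ℕ∞) < N → 0 ≤ mu (k + 1))
    (ha0 : ∀ t, 0 ≤ t → 0 ≤ a t) (hb0 : ∀ t, 0 ≤ t → 0 ≤ b t)
    (hai : ∀ t, 0 ≤ t → IntervalIntegrable a volume 0 t)
    (hbi : ∀ t, 0 ≤ t → IntervalIntegrable b volume 0 t) (k : ℕ) (hk : (k : ℕ∞) ≤ N)
    {Λ : ℝ} (hΛ : ∀ i < k, lam i ≤ Λ) {t : ℝ} (ht : 0 ≤ t) :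
    s k t ≤ (Λ * ∫ u in (0 : ℝ)..t, a u) ^ k / k.factorial := by
  induction k generalizing t with
  | zero => simp [h.zero t ht]
  | succ k ih =>
    have hkN : (k : ℕ∞) < N := lt_of_lt_of_le (by exact_mod_cast k.lt_succ_self) hk
    have hΛ0 : 0 ≤ Λ := (hlam k hkN).trans (hΛ k k.lt_succ_self)
    rw [h.integral_eq k hkN t ht]
    have hR : IntervalIntegrable (fun u => a u * (∫ v in (0 : ℝ)..u, a v) ^ k) volume 0 t :=
      (hai t ht).mul_continuousOn
        ((absolutelyContinuousOnInterval_primitive (hai t ht)).continuousOn.pow k)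
    calc _ ≤ ∫ u in (0 : ℝ)..t, Λ ^ (k + 1) / k.factorial *
          (a u * (∫ v in (0 : ℝ)..u, a v) ^ k) := by
          refine intervalIntegral.integral_mono_on ht (h.intervalIntegrable hai hbi k ht)
            (hR.const_mul _) fun u hu => ?_
          have h1 : 0 ≤ mu (k + 1) * b u * (s (k + 1) u - s (k + 2) u) :=
            mul_nonneg (mul_nonneg (hmu k hkN) (hb0 u hu.1))
              (sub_nonneg.2 (h.anti (k + 1) u hu.1))
          have h2 : lam k * a u * (s k u - s (k + 1) u) ≤ Λ * a u * s k u :=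
            mul_le_mul (mul_le_mul_of_nonneg_right (hΛ k k.lt_succ_self) (ha0 u hu.1))
              (by linarith [h.nonneg (k + 1) u hu.1]) (sub_nonneg.2 (h.anti k u hu.1))
              (mul_nonneg hΛ0 (ha0 u hu.1))
          have h3 := mul_le_mul_of_nonneg_left (ih hkN.le (fun i hi => hΛ i (by omega)) hu.1) (mul_nonneg hΛ0 (ha0 u hu.1))
          have h4 : Λ * a u * ((Λ * ∫ v in (0 : ℝ)..u, a v) ^ k / k.factorial) =
              Λ ^ (k + 1) / k.factorial * (a u * (∫ v in (0 : ℝ)..u, a v) ^ k) := by ring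
          linarith
      _ = _ := by
          rw [intervalIntegral.integral_const_mul, integral_mul_primitive_pow (hai t ht),
            mul_pow, Nat.factorial_succ, Nat.cast_mul, div_mul_div_comm, Nat.cast_succ,
            mul_comm ((k : ℝ) + 1)]

end IsSurvival

/-! ### Weighted sums of survival functions, truncated at level `m` -/

theorem dWeight_pos {δ : ℕ → ℝ} {n : ℕ} (h : ∀ k, 1 ≤ k → k ≤ n → 0 < δ k) : 0 < dWeight δ n := by
  induction n with
  | zero => simp [dWeight]
  | succ n ih => exact mul_pos (h _ (by omega) le_rfl) (ih fun k h1 h2 => h k h1 (by omega))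

/-- Summation by parts: since `d_{k+1} = δ_{k+1} d_k` and `d_{k-1} = δ_k⁻¹ d_k`, the coefficient of
`s_{k+1}` is `-d_k α_k`, which is the reason for the form of `α_k`. The last two terms correct for
the truncation at `m`. -/
theorem sum_dWeight_mul (birth death : ℕ → ℝ → ℝ) (δ s : ℕ → ℝ) (t : ℝ) (h0 : death 0 t = 0)
    (m : ℕ) (hδ : ∀ k, 1 ≤ k → k ≤ m → 0 < δ k) :
    ∑ k ∈ Finset.range (m + 1), dWeight δ k *
        (birth k t * (s k - s (k + 1)) - death (k + 1) t * (s (k + 1) - s (k + 2))) =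
      birth 0 t * s 0 -
        ∑ k ∈ Finset.range (m + 1), dWeight δ k * alpha birth death δ k t * s (k + 1) -
        δ (m + 1) * dWeight δ m * birth (m + 1) t * s (m + 1) +
        dWeight δ m * death (m + 1) t * s (m + 2) := by
  induction m with
  | zero =>
    simp [dWeight, alpha, h0]
    ring
  | succ m ih =>
    rw [Finset.sum_range_succ, ih fun k h1 h2 => hδ k h1 (by omega),
      Finset.sum_range_succ _ (m + 1)]
    have : δ (m + 1) ≠ 0 := (hδ (m + 1) (by omega) le_rfl).ne'
    simp only [dWeight, alpha]
    field_simp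
    ring

theorem IsSurvival.qWeight_mul_le {N : ℕ∞} {lam mu : ℕ → ℝ} {a b l : ℝ → ℝ} {s : ℕ → ℝ → ℝ}
    {δ : ℕ → ℝ} (h : IsSurvival N lam mu a b s)
    (hlam : ∀ k : ℕ, (k : ℕ∞) < N → 0 ≤ lam k) (hmu0 : mu 0 = 0)
    (hlamN : ∀ n : ℕ, N = ((n + 1 : ℕ) : ℕ∞) → lam (n + 1) = 0)
    (ha0 : ∀ t, 0 ≤ t → 0 ≤ a t)
    (hai : ∀ t, 0 ≤ t → IntervalIntegrable a volume 0 t)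
    (hbi : ∀ t, 0 ≤ t → IntervalIntegrable b volume 0 t)
    (hli : ∀ t, 0 ≤ t → IntervalIntegrable l volume 0 t)
    (hδ : IsWeight N (fun n t => lam n * a t) (fun n t => mu n * b t) l δ)
    {m j : ℕ} (hm : (m : ℕ∞) < N) (hj : j ≤ m) {t : ℝ} (ht : 0 ≤ t) :
    qWeight δ (j + 1) * s (j + 1) t ≤ ∫ x in (0 : ℝ)..t,
      Real.exp (-((∫ u in (0 : ℝ)..t, l u) - ∫ u in (0 : ℝ)..x, l u)) *
        (lam 0 * a x + dWeight δ m * mu (m + 1) * (b x * s (m + 2) x)) := by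
  have hlt : ∀ k, k ≤ m → (k : ℕ∞) < N := fun k hk => lt_of_le_of_lt (by exact_mod_cast hk) hm
  have hδm : ∀ k, 1 ≤ k → k ≤ m → 0 < δ k := fun k h1 h2 => hδ.pos k h1 (hlt k h2)
  have hd : ∀ k, k ≤ m → 0 < dWeight δ k := fun k hk =>
    dWeight_pos fun i h1 h2 => hδm i h1 (h2.trans hk)
  set v : ℝ → ℝ := fun u => ∑ k ∈ Finset.range (m + 1), dWeight δ k *
    (lam k * a u * (s k u - s (k + 1) u) -
      mu (k + 1) * b u * (s (k + 1) u - s (k + 2) u)) with hv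
  have hvi : ∀ t, 0 ≤ t → IntervalIntegrable v volume 0 t := fun t ht =>
    intervalIntegrable_sum _ fun k _ => (h.intervalIntegrable hai hbi k ht).const_mul _
  have hV : ∀ t, 0 ≤ t →
      ∫ u in (0 : ℝ)..t, v u = ∑ k ∈ Finset.range (m + 1), dWeight δ k * s (k + 1) t := by
    intro t ht
    rw [intervalIntegral.integral_finsetSum fun k _ =>
      (h.intervalIntegrable hai hbi k ht).const_mul _]
    refine Finset.sum_congr rfl fun k hk => ?_
    rw [intervalIntegral.integral_const_mul,
      ← h.integral_eq k (hlt k (by simpa [Nat.lt_succ_iff] using hk)) t ht]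
  have hq : qWeight δ (j + 1) * s (j + 1) t ≤ ∫ u in (0 : ℝ)..t, v u := by
    rw [hV t ht, qWeight, Finset.sum_mul]
    calc _ ≤ ∑ k ∈ Finset.range (j + 1), dWeight δ k * s (k + 1) t :=
          Finset.sum_le_sum fun k hk => by
            rw [Finset.mem_range] at hk
            exact mul_le_mul_of_nonneg_left (h.antitone ht (by omega)) (hd k (by omega)).le
      _ ≤ _ := by
          refine Finset.sum_le_sum_of_subset_of_nonneg (by simpa using hj) fun k hk _ => ?_
          rw [Finset.mem_range] at hk
          exact mul_nonneg (hd k (by omega)).le (h.nonneg _ t ht)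
  refine hq.trans (primitive_le_of_gronwall ht (hvi t ht) (hli t ht) ?_ fun x hx hxt => ?_)
  · exact ((hai t ht).const_mul _).add
      (((hbi t ht).mul_continuousOn (h.continuousOn_uIcc (m + 2) ht)).const_mul _)
  · have key := sum_dWeight_mul (fun n t => lam n * a t) (fun n t => mu n * b t) δ
      (fun k => s k x) x (by simp [hmu0]) m hδm
    -- This boundary term enters with a minus sign and can be dropped. For `m + 1 = N` the sign of
    -- `δ N` is unknown, but `lam N = 0`.
    have hbd : 0 ≤ δ (m + 1) * dWeight δ m * (lam (m + 1) * a x) * s (m + 1) x := by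
      rcases (Order.add_one_le_of_lt hm).lt_or_eq with h1 | h1
      · have h1' : ((m + 1 : ℕ) : ℕ∞) < N := by exact_mod_cast h1
        exact mul_nonneg (mul_nonneg (mul_nonneg (hδ.pos _ (by omega) h1').le (hd m le_rfl).le)
          (mul_nonneg (hlam _ h1') (ha0 x hx))) (h.nonneg _ x hx)
      · rw [hlamN m (by rw [← h1]; norm_cast)]
        simp
    have hsum : l x * ∑ k ∈ Finset.range (m + 1), dWeight δ k * s (k + 1) x ≤
        ∑ k ∈ Finset.range (m + 1), dWeight δ k *
          alpha (fun n t => lam n * a t) (fun n t => mu n * b t) δ k x * s (k + 1) x := by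
      rw [Finset.mul_sum]
      refine Finset.sum_le_sum fun k hk => ?_
      rw [Finset.mem_range] at hk
      have h1 := hδ.le_alpha x hx k (hlt k (by omega))
      have h2 := mul_le_mul_of_nonneg_right h1
        (mul_nonneg (hd k (by omega)).le (h.nonneg (k + 1) x hx))
      linarith
    rw [hV x hx]
    simp only [h.zero x hx, mul_one] at key
    simp only [hv]
    rw [key]
    linarith

theorem tendsto_pow_div_factorial_shift (x : ℝ) :
    Tendsto (fun m : ℕ => x ^ (m + 2) / (m + 2).factorial) atTop (𝓝 0) :=
  (tendsto_add_atTop_iff_nat 2).2 (FloorSemiring.tendsto_pow_div_factorial_atTop x)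

/-! ### Positivity and bounds of the rates -/

namespace IsRates

variable {N : ℕ∞} {lam mu : ℕ → ℝ} {lamL muL : ℝ}

theorem limits_pos (h : IsRates N lam mu lamL muL) : 0 < lamL ∧ 0 < muL := by
  induction N with
  | top => exact ⟨(h.infinite rfl).2.1, (h.infinite rfl).2.2.2⟩
  | coe n =>
    obtain _ | n := n
    · exact absurd h.one_le (by simp)
    · obtain ⟨-, h1, h2⟩ := h.finite n rfl
      rw [h1, h2]
      exact ⟨h.lam_pos n (by exact_mod_cast n.lt_succ_self), h.mu_pos (n + 1) (by omega) le_rfl⟩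

theorem lam_bounds (h : IsRates ⊤ lam mu lamL muL) :
    ∃ Λ R : ℝ, ∀ k, lam k ≤ Λ ∧ (lam k)⁻¹ ≤ R := by
  obtain ⟨h1, h2, -⟩ := h.infinite rfl
  obtain ⟨Λ, hΛ⟩ := h1.bddAbove_range
  obtain ⟨R, hR⟩ := (h1.inv₀ h2.ne').bddAbove_range
  exact ⟨Λ, R, fun k => ⟨hΛ ⟨k, rfl⟩, hR ⟨k, rfl⟩⟩⟩

theorem mu_bound (h : IsRates ⊤ lam mu lamL muL) : ∃ M : ℝ, ∀ k, mu k ≤ M := by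
  obtain ⟨-, -, h1, -⟩ := h.infinite rfl
  obtain ⟨M, hM⟩ := h1.bddAbove_range
  exact ⟨M, fun k => hM ⟨k, rfl⟩⟩

end IsRates

/-! ### Admissible weights -/

/-- A quadratic polynomial `A x² - B x - C` with `A > 0`, `C ≥ 0` is nonpositive between `0` and
its larger root. -/
theorem mul_sq_le_of_le_root {A B C x : ℝ} (hA : 0 < A) (hC : 0 ≤ C) (hx : 0 ≤ x)
    (h : x ≤ (B + Real.sqrt (B ^ 2 + 4 * A * C)) / (2 * A)) : A * x ^ 2 ≤ B * x + C := by
  rw [le_div_iff₀ (by positivity)] at h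
  have h1 : 2 * A * x - B ≤ Real.sqrt (B ^ 2 + 4 * A * C) := by linarith
  -- `C ≥ 0` makes the square root at least `|B|`, so the smaller root is nonpositive and `x ≥ 0`
  -- lies above it.
  have h2 : -Real.sqrt (B ^ 2 + 4 * A * C) ≤ 2 * A * x - B := by
    have := Real.abs_le_sqrt (x := B) (y := B ^ 2 + 4 * A * C) (by nlinarith [mul_nonneg hA.le hC])
    have := (abs_le.1 this).2
    nlinarith [mul_nonneg hA.le hx]
  have h3 := sq_le_sq.2 ((abs_le.2 ⟨h2, h1⟩).trans (le_abs_self _))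
  rw [Real.sq_sqrt (by nlinarith [mul_nonneg hA.le hC, sq_nonneg B])] at h3
  nlinarith

theorem Conditions.quadratic_le {N : ℕ∞} {lam mu : ℕ → ℝ} {lamL muL am bm Δ c : ℝ}
    (hlam : 0 < lamL) (hmu : 0 < muL) (h : Conditions N lam mu lamL muL am bm Δ c) {k : ℕ}
    (hk : (k : ℕ∞) < N) : lam k * mu k ≤ (prev lam k + c * Δ * lamL) * (mu (k + 1) - c * muL) := by
  have hΔ : 0 < Δ := one_pos.trans h.one_lt_Δ
  -- The real infimum of a set unbounded below is `0` by convention, so positivity of `fInf` forces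
  -- boundedness.
  have hbdd : BddBelow (Set.range fun k : {k : ℕ // (k : ℕ∞) < N} =>
      fRoot lam mu lamL muL Δ k) := by
    by_contra hb
    have := h.fInf_pos
    rw [fInf, iInf, Real.sInf_of_not_bddBelow hb] at this
    exact lt_irrefl _ this
  have h1 : c ≤ fRoot lam mu lamL muL Δ k := h.c_le_fInf.trans (ciInf_le hbdd ⟨k, hk⟩)
  have h2 := mul_sq_le_of_le_root (A := Δ * lamL * muL)
    (B := Δ * lamL * mu (k + 1) - prev lam k * muL)
    (C := prev lam k * mu (k + 1) - lam k * mu k) (by positivity) (h.cross k hk) h.c_pos.le (by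
      rw [fRoot] at h1
      convert h1 using 2
      · ring_nf
      · ring)
  linarith

theorem exists_isWeight {N : ℕ∞} {lam mu : ℕ → ℝ} {lamL muL : ℝ}
    (hrates : IsRates N lam mu lamL muL) {a b : ℝ → ℝ} (ha : ∀ t, 0 ≤ t → 0 ≤ a t)
    (hb : ∀ t, 0 ≤ t → 0 ≤ b t) {am bm Δ c : ℝ}
    (hcond : Conditions N lam mu lamL muL am bm Δ c) :
    ∃ δ : ℕ → ℝ, IsWeight N (fun n t => lam n * a t) (fun n t => mu n * b t)
      (fun t => c * (muL * b t - Δ * lamL * a t)) δ := by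
  obtain ⟨hL, hM⟩ := hrates.limits_pos
  have hΔ : 0 < Δ := one_pos.trans hcond.one_lt_Δ
  have hc := hcond.c_pos
  have hcΔ : 0 < c * Δ * lamL := by positivity
  have hprev : ∀ k : ℕ, (k : ℕ∞) < N → 0 ≤ prev lam k := by
    rintro (_ | k) hk
    · exact le_rfl
    · exact (hrates.lam_pos k (lt_trans (by exact_mod_cast k.lt_succ_self) hk)).le
  have hpos : ∀ k : ℕ, (k : ℕ∞) < N → 0 < (prev lam k + c * Δ * lamL) / lam k := fun k hk =>
    div_pos (by linarith [hprev k hk]) (hrates.lam_pos k hk)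
  -- Chosen so that `δ_{k+1} λ_{k+1} = λ_k + cΔλ`, which matches the coefficient of `a` in `l(t)`
  -- exactly. For `N = ∞` its limit is `1 + cΔ > 1`.
  refine ⟨fun k => (prev lam k + c * Δ * lamL) / lam k, fun k _ hk => hpos k hk, ?_, ?_⟩
  · rintro rfl
    obtain ⟨h1, -, -⟩ := hrates.infinite rfl
    have h2 : Tendsto (fun k => (prev lam (k + 1) + c * Δ * lamL) / lam (k + 1)) atTop
        (𝓝 ((lamL + c * Δ * lamL) / lamL)) :=
      (h1.add_const _).div ((tendsto_add_atTop_iff_nat 1).2 h1) hL.ne'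
    have h3 := (tendsto_add_atTop_iff_nat (f := fun k => (prev lam k + c * Δ * lamL) / lam k) 1).1 h2
    have h4 : (1 + c * Δ / 2) < (lamL + c * Δ * lamL) / lamL := by
      rw [lt_div_iff₀ hL]
      nlinarith
    exact ⟨1 + c * Δ / 2, by nlinarith [mul_pos hc hΔ], h3.eventually_const_le h4⟩
  · intro t ht k hk
    have hA : ((prev lam (k + 1) + c * Δ * lamL) / lam (k + 1)) * lam (k + 1) ≤
        lam k + c * Δ * lamL := by
      -- The rate vanishes only at `k + 1 = N`; there equality weakens to `0 ≤ λ_k + cΔλ`.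
      rcases eq_or_ne (lam (k + 1)) 0 with h0 | h0
      · rw [h0, mul_zero]
        linarith [hrates.lam_pos k hk]
      · rw [div_mul_cancel₀ _ h0, prev]
    have hratio : 0 < mu (k + 1) - c * muL := by
      have := hcond.c_lt_ratio k hk
      rw [lt_div_iff₀ hM] at this
      linarith
    have hB : ((prev lam k + c * Δ * lamL) / lam k)⁻¹ * mu k ≤ mu (k + 1) - c * muL := by
      rw [inv_div, div_mul_eq_mul_div, div_le_iff₀ (by linarith [hprev k hk])]
      linarith [hcond.quadratic_le hL hM hk]
    have h1 := mul_le_mul_of_nonneg_right hA (ha t ht)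
    have h2 := mul_le_mul_of_nonneg_right hB (hb t ht)
    simp only [alpha]
    linarith

/-- At a time with `a t > 0`, the inequality `l ≤ α_k` caps `δ_{k+1} λ_{k+1} a`. The cap is uniform
in `k` because the rates are bounded and the inverses of the `λ_k` are too. -/
theorem IsWeight.le_of_pos {lam mu : ℕ → ℝ} {a b l : ℝ → ℝ} {δ : ℕ → ℝ}
    (hδ : IsWeight ⊤ (fun n t => lam n * a t) (fun n t => mu n * b t) l δ)
    (hlam : ∀ k, 0 < lam k) (hmu : ∀ k, 0 ≤ mu k) (hmu0 : mu 0 = 0) {Λ R M : ℝ}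
    (hΛ : ∀ k, lam k ≤ Λ) (hR : ∀ k, (lam k)⁻¹ ≤ R) (hM : ∀ k, mu k ≤ M)
    {t : ℝ} (ht : 0 ≤ t) (ha : 0 < a t) (hb : 0 ≤ b t) (k : ℕ) :
    δ (k + 1) ≤ (Λ * a t + M * b t + |l t|) / a t * R := by
  have h1 := hδ.le_alpha t ht k (by exact_mod_cast ENat.natCast_lt_top k)
  simp only [alpha] at h1
  have h2 : 0 ≤ (δ k)⁻¹ * (mu k * b t) := by
    obtain _ | k := k
    · simp [hmu0]
    · exact mul_nonneg (inv_nonneg.2 (hδ.pos _ (by omega) (by exact_mod_cast ENat.natCast_lt_top _)).le)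
        (mul_nonneg (hmu _) hb)
  have h3 : δ (k + 1) * (lam (k + 1) * a t) ≤ Λ * a t + M * b t + |l t| := by
    have := mul_le_mul_of_nonneg_right (hΛ k) ha.le
    have := mul_le_mul_of_nonneg_right (hM (k + 1)) hb
    linarith [neg_abs_le (l t)]
  have h4 : 0 ≤ Λ * a t + M * b t + |l t| := by
    have := (hlam 0).le.trans (hΛ 0)
    have := (hmu 0).trans (hM 0)
    positivity
  have h5 := hlam (k + 1)
  calc δ (k + 1) ≤ (Λ * a t + M * b t + |l t|) / a t * (lam (k + 1))⁻¹ := by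
        rw [← div_eq_mul_inv, div_div, le_div_iff₀ (by positivity), mul_comm (a t)]
        exact h3
    _ ≤ _ := mul_le_mul_of_nonneg_left (hR _) (by positivity)

/-! ### Removal of the truncation -/

theorem dWeight_le_pow {δ : ℕ → ℝ} {D : ℝ} (hpos : ∀ k, 0 < δ (k + 1)) (hD : ∀ k, δ (k + 1) ≤ D)
    (n : ℕ) : dWeight δ n ≤ D ^ n := by
  have h0 : 0 ≤ D := (hpos 0).le.trans (hD 0)
  induction n with
  | zero => simp [dWeight]
  | succ n ih =>
    rw [pow_succ', dWeight]
    exact mul_le_mul (hD n) ih (dWeight_pos fun k h1 _ => by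
      obtain ⟨k, rfl⟩ := Nat.exists_eq_add_of_le' h1; exact hpos k).le h0

theorem IsSurvival.qWeight_mul_le_integral {N : ℕ∞} {lam mu : ℕ → ℝ} {lamL muL : ℝ}
    (hrates : IsRates N lam mu lamL muL) {a b l : ℝ → ℝ} {s : ℕ → ℝ → ℝ}
    {δ : ℕ → ℝ} (h : IsSurvival N lam mu a b s)
    (ha0 : ∀ t, 0 ≤ t → 0 ≤ a t) (hb0 : ∀ t, 0 ≤ t → 0 ≤ b t)
    (hai : ∀ t, 0 ≤ t → IntervalIntegrable a volume 0 t)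
    (hbi : ∀ t, 0 ≤ t → IntervalIntegrable b volume 0 t)
    (hli : ∀ t, 0 ≤ t → IntervalIntegrable l volume 0 t)
    (hapos : ∃ t, 0 ≤ t ∧ 0 < a t)
    (hδ : IsWeight N (fun n t => lam n * a t) (fun n t => mu n * b t) l δ)
    {j : ℕ} (hj : (j : ℕ∞) < N) {t : ℝ} (ht : 0 ≤ t) :
    qWeight δ (j + 1) * s (j + 1) t ≤ lam 0 * ∫ x in (0 : ℝ)..t,
      Real.exp (-((∫ u in (0 : ℝ)..t, l u) - ∫ u in (0 : ℝ)..x, l u)) * a x := by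
  have hlam : ∀ k : ℕ, (k : ℕ∞) < N → 0 ≤ lam k := fun k hk => (hrates.lam_pos k hk).le
  have hlamN : ∀ n : ℕ, N = ((n + 1 : ℕ) : ℕ∞) → lam (n + 1) = 0 := fun n hn =>
    (hrates.finite n hn).1
  have main := fun (m : ℕ) (hm : (m : ℕ∞) < N) (hjm : j ≤ m) =>
    h.qWeight_mul_le hlam hrates.mu_zero hlamN ha0 hai hbi hli hδ hm hjm ht
  set E : ℝ → ℝ := fun x => Real.exp (-((∫ u in (0 : ℝ)..t, l u) - ∫ u in (0 : ℝ)..x, l u)) with hE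
  have hEc : ContinuousOn E (Set.uIcc 0 t) :=
    ((continuousOn_const.sub
      (absolutelyContinuousOnInterval_primitive (hli t ht)).continuousOn).neg).rexp
  have hEa : IntervalIntegrable (fun x => E x * a x) volume 0 t :=
    (hai t ht).continuousOn_mul hEc
  have hEb : IntervalIntegrable (fun x => E x * b x) volume 0 t :=
    (hbi t ht).continuousOn_mul hEc
  induction N with
  | coe n =>
    obtain _ | n := n
    · exact absurd hrates.one_le (by simp)
    -- Here `N = n + 1`; with `m = n` the boundary term contains `s (n + 2)`, which is zero above
    -- `N`.
    have h1 := main n (by exact_mod_cast n.lt_succ_self)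
      (Nat.lt_succ_iff.1 (by exact_mod_cast hj))
    refine h1.trans_eq ?_
    rw [← intervalIntegral.integral_const_mul]
    refine intervalIntegral.integral_congr fun x hx => ?_
    rw [Set.uIcc_of_le ht] at hx
    rw [h.top (n + 2) (by exact_mod_cast (n + 1).lt_succ_self) x hx.1]
    ring
  | top =>
    obtain ⟨t₀, ht₀, hat₀⟩ := hapos
    obtain ⟨Λ, R, hΛR⟩ := hrates.lam_bounds
    obtain ⟨M, hM⟩ := hrates.mu_bound
    have hlt : ∀ k : ℕ, (k : ℕ∞) < ⊤ := ENat.natCast_lt_top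
    have hlam' : ∀ k, 0 < lam k := fun k => hrates.lam_pos k (hlt k)
    have hmu : ∀ k, 0 ≤ mu k := by
      rintro (_ | k)
      · exact hrates.mu_zero.ge
      · exact (hrates.mu_pos _ (by omega) (hlt _).le).le
    have hM0 : 0 ≤ M := (hmu 0).trans (hM 0)
    have hΛ0 : 0 ≤ Λ := (hlam' 0).le.trans (hΛR 0).1
    have hδpos : ∀ k, 0 < δ (k + 1) := fun k => hδ.pos _ (by omega) (hlt _)
    obtain ⟨D, hD1, hD⟩ : ∃ D : ℝ, 1 ≤ D ∧ ∀ k, δ (k + 1) ≤ D :=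
      ⟨_, le_max_left 1 _, fun k => (hδ.le_of_pos hlam' hmu hrates.mu_zero (fun k => (hΛR k).1)
        (fun k => (hΛR k).2) hM ht₀ hat₀ (hb0 t₀ ht₀) k).trans (le_max_right _ _)⟩
    set A := ∫ u in (0 : ℝ)..t, a u with hA
    set B := ∫ x in (0 : ℝ)..t, E x * b x with hB
    have hAmono : ∀ x, 0 ≤ x → x ≤ t → 0 ≤ ∫ u in (0 : ℝ)..x, a u ∧ ∫ u in (0 : ℝ)..x, a u ≤ A :=
      fun x hx hxt => ⟨intervalIntegral.integral_nonneg hx fun u hu => ha0 u hu.1, by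
        rw [hA, ← intervalIntegral.integral_add_adjacent_intervals (hai x hx)
          ((hai x hx).symm.trans (hai t ht))]
        have : 0 ≤ ∫ u in x..t, a u :=
          intervalIntegral.integral_nonneg hxt fun u hu => ha0 u (hx.trans hu.1)
        linarith⟩
    -- The exponent of `D` is raised from `m` to `m + 2` (allowed by `1 ≤ D`) to match the
    -- factorial, so that the error is a term of an exponential series.
    have hbound : ∀ m, j ≤ m → qWeight δ (j + 1) * s (j + 1) t ≤
        lam 0 * (∫ x in (0 : ℝ)..t, E x * a x) +
          M * ((D * (Λ * A)) ^ (m + 2) / (m + 2).factorial) * B := by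
      intro m hjm
      refine (main m (hlt m) hjm).trans ?_
      rw [hB, ← intervalIntegral.integral_const_mul, ← intervalIntegral.integral_const_mul,
        ← intervalIntegral.integral_add (hEa.const_mul _) (hEb.const_mul _)]
      refine intervalIntegral.integral_mono_on ht ?_ ((hEa.const_mul _).add (hEb.const_mul _))
        fun x hx => ?_
      · exact (((hai t ht).const_mul _).add (((hbi t ht).mul_continuousOn
          (h.continuousOn_uIcc (m + 2) ht)).const_mul _)).continuousOn_mul hEc
      · have hE0 : 0 < E x := Real.exp_pos _
        have hs : s (m + 2) x ≤ (Λ * A) ^ (m + 2) / (m + 2).factorial := by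
          refine (h.le_pow_div_factorial hlam (fun k _ => hmu _) ha0 hb0 hai hbi (m + 2) le_top
            (fun k _ => (hΛR k).1) hx.1).trans ?_
          obtain ⟨h1, h2⟩ := hAmono x hx.1 hx.2
          gcongr
        have hdw : dWeight δ m ≤ D ^ (m + 2) :=
          (dWeight_le_pow hδpos hD m).trans (pow_le_pow_right₀ hD1 (by omega))
        have hdw0 : 0 ≤ dWeight δ m := (dWeight_pos fun k h1 _ => hδ.pos k h1 (hlt k)).le
        have h3 : dWeight δ m * mu (m + 1) * s (m + 2) x ≤
            D ^ (m + 2) * M * ((Λ * A) ^ (m + 2) / (m + 2).factorial) :=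
          mul_le_mul (mul_le_mul hdw (hM _) (hmu _) (by positivity)) hs (h.nonneg _ x hx.1)
            (by positivity)
        have h4 := mul_le_mul_of_nonneg_left h3 (mul_nonneg hE0.le (hb0 x hx.1))
        rw [mul_pow D]
        linarith [h4, mul_div_assoc (D ^ (m + 2)) ((Λ * A) ^ (m + 2)) ((m + 2).factorial : ℝ),
          show E x * b x * (D ^ (m + 2) * M * ((Λ * A) ^ (m + 2) / (m + 2).factorial)) =
            M * (D ^ (m + 2) * (Λ * A) ^ (m + 2) / (m + 2).factorial) * (E x * b x) by ring]
    refine ge_of_tendsto (f := fun m : ℕ => lam 0 * (∫ x in (0 : ℝ)..t, E x * a x) +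
      M * ((D * (Λ * A)) ^ (m + 2) / (m + 2).factorial) * B) ?_
      ((eventually_ge_atTop j).mono hbound)
    have := (((tendsto_pow_div_factorial_shift (D * (Λ * A))).const_mul M).mul_const B).const_add
      (lam 0 * ∫ x in (0 : ℝ)..t, E x * a x)
    rwa [mul_zero, zero_mul, add_zero] at this

/-! ### The arrival function integrated against the decay kernel -/

theorem exists_integral_exp_le {a a₁ a₂ b b₁ b₂ : ℝ → ℝ} {T₁ T₂ : ℝ}
    (ha : IsAsympPeriodic a a₁ a₂ T₁) (hb : IsAsympPeriodic b b₁ b₂ T₂) {x y : ℝ} (hx : 0 ≤ x)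
    (hy : 0 ≤ y) (hpos : 0 < x * mean b₁ T₂ - y * mean a₁ T₁) :
    ∃ C, 0 < C ∧ ∀ t, 0 ≤ t → ∫ r in (0 : ℝ)..t,
      Real.exp (-((∫ u in (0 : ℝ)..t, (x * b u - y * a u)) -
        ∫ u in (0 : ℝ)..r, (x * b u - y * a u))) * a r ≤ C := by
  set m := x * mean b₁ T₂ - y * mean a₁ T₁ with hm
  -- Small enough that the fluctuations of `x b - y a` cost at most half of its mean `m`.
  set ε := m / (2 * (x + y + 1)) with hε
  have hε0 : 0 < ε := by positivity
  have hεm : (x + y) * ε ≤ m / 2 := by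
    rw [hε, mul_div_assoc', div_le_div_iff₀ (by positivity) (by positivity)]
    nlinarith
  obtain ⟨C₁, hC₁⟩ := ha.abs_integral_sub_le hε0
  obtain ⟨C₂, hC₂⟩ := hb.abs_integral_sub_le hε0
  set f : ℝ → ℝ := fun u => x * b u - y * a u with hf
  have hfi : ∀ s t, 0 ≤ s → 0 ≤ t → IntervalIntegrable f volume s t := fun s t hs ht =>
    ((hb.intervalIntegrable hs ht).const_mul _).sub ((ha.intervalIntegrable hs ht).const_mul _)
  set C₃ := x * C₂ + y * C₁
  have hlow : ∀ r t, 0 ≤ r → r ≤ t →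
      m / 2 * (t - r) - C₃ ≤ (∫ u in (0 : ℝ)..t, f u) - ∫ u in (0 : ℝ)..r, f u := by
    intro r t hr hrt
    have ht := hr.trans hrt
    rw [intervalIntegral.integral_interval_sub_left (hfi 0 t le_rfl ht) (hfi 0 r le_rfl hr), hf,
      intervalIntegral.integral_sub ((hb.intervalIntegrable hr ht).const_mul _)
        ((ha.intervalIntegrable hr ht).const_mul _), intervalIntegral.integral_const_mul,
      intervalIntegral.integral_const_mul]
    have h1 := mul_le_mul_of_nonneg_left (abs_le.1 (hC₁ r t hr hrt)).2 hy
    have h2 := mul_le_mul_of_nonneg_left (abs_le.1 (hC₂ r t hr hrt)).1 hx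
    have h3 := mul_le_mul_of_nonneg_right hεm (sub_nonneg.2 hrt)
    have h4 : m * (t - r) = x * (mean b₁ T₂ * (t - r)) - y * (mean a₁ T₁ * (t - r)) := by
      rw [hm]
      ring
    simp only [C₃]
    linarith
  set M := |mean a₁ T₁| + ε + |C₁|
  have hM : ∀ s t, 0 ≤ s → s ≤ t → t ≤ s + 1 → ∫ u in s..t, a u ≤ M := by
    intro s t hs hst hts
    have h1 := (abs_le.1 (hC₁ s t hs hst)).2
    have h2 : mean a₁ T₁ * (t - s) ≤ |mean a₁ T₁| := by
      nlinarith [le_abs_self (mean a₁ T₁), abs_nonneg (mean a₁ T₁)]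
    have h3 : ε * (t - s) ≤ ε := by nlinarith
    linarith [le_abs_self C₁]
  have hm2 : 0 < m / 2 := by positivity
  have hd : 0 < 1 - Real.exp (-(m / 2)) := by simpa using hm2
  refine ⟨Real.exp C₃ * (M / (1 - Real.exp (-(m / 2)))), by positivity, fun t ht => ?_⟩
  refine le_trans ?_ (mul_le_mul_of_nonneg_left (integral_exp_mul_le hm2 ha.nonneg
    (fun s t hs ht => ha.intervalIntegrable hs ht) hM ht) (Real.exp_pos _).le)
  rw [← intervalIntegral.integral_const_mul]
  have hai := ha.intervalIntegrable le_rfl ht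
  refine intervalIntegral.integral_mono_on ht (hai.continuousOn_mul ?_)
    ((hai.continuousOn_mul (by fun_prop)).const_mul _) fun r hr => ?_
  · exact ((continuousOn_const.sub
      (absolutelyContinuousOnInterval_primitive (hfi 0 t le_rfl ht)).continuousOn).neg).rexp
  · rw [← mul_assoc, ← Real.exp_add]
    refine mul_le_mul_of_nonneg_right (Real.exp_le_exp.2 ?_) (ha.nonneg r hr.1)
    linarith [hlow r t hr.1 hr.2]

/-! ### From the process to its transition function -/

theorem IsBirthDeathProcess.exists_cond_eq {Ω : Type*} [MeasurableSpace Ω] {P : Measure Ω}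
    [IsProbabilityMeasure P] {N : ℕ∞} {birth death : ℕ → ℝ → ℝ} {X : ℝ → Ω → ℕ}
    (hX : IsBirthDeathProcess P N birth death X) (hX0 : P {ω | X 0 ω = 0} ≠ 0) :
    ∃ p, IsTransitionFunction N birth death p ∧ ∀ t, 0 ≤ t → ∀ j : ℕ, (j : ℕ∞) ≤ N →
      (ProbabilityTheory.cond P {ω | X 0 ω = 0}).real {ω | X t ω ≤ j} =
        1 - survival p (j + 1) t := by
  obtain ⟨p, hp, hm⟩ := hX.markov
  refine ⟨p, hp, fun t ht j hj => ?_⟩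
  have hms : ∀ t, 0 ≤ t → ∀ i, MeasurableSet {ω | X t ω = i} := fun t ht i =>
    hX.measurable t ht (measurableSet_singleton i)
  have h0 := hms 0 le_rfl 0
  have hP0 : P.real {ω | X 0 ω = 0} ≠ 0 := by
    rwa [Measure.real, ENNReal.toReal_ne_zero, and_iff_left (measure_ne_top _ _)]
  have hunion : {ω | X t ω ≤ j} = ⋃ i ∈ Finset.range (j + 1), {ω | X t ω = i} := by
    ext ω
    simp
  rw [survival, sub_sub_cancel, hunion, measureReal_biUnion_finset
    (fun i _ k _ hik => Set.disjoint_left.2 fun ω h1 h2 => hik (h1.symm.trans h2))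
    (fun i _ => hms t ht i)]
  refine Finset.sum_congr rfl fun i hi => ?_
  have hiN : (i : ℕ∞) ≤ N := le_trans (by
    rw [Finset.mem_range] at hi
    exact_mod_cast Nat.lt_succ_iff.1 hi) hj
  -- The Markov property at time `0` with the trivial past event.
  have h1 := hm 0 t le_rfl ht Set.univ MeasurableSet.univ 0 i (by simp) hiN
  rw [Set.univ_inter] at h1
  rw [Measure.real, ProbabilityTheory.cond_apply h0, ENNReal.toReal_mul, ENNReal.toReal_inv,
    ← Measure.real, ← Measure.real, h1]
  field_simp

end BDP

/-! ### Existence of admissible weights and the lower bound -/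

theorem theorem2
    -- rates, limit values and basic functions
    (N : ℕ∞) (lam mu : ℕ → ℝ) (lamL muL : ℝ) (hrates : BDP.IsRates N lam mu lamL muL)
    (a a₁ a₂ b b₁ b₂ : ℝ → ℝ) (T₁ T₂ : ℝ)
    (ha : BDP.IsAsympPeriodic a a₁ a₂ T₁) (hb : BDP.IsAsympPeriodic b b₁ b₂ T₂)
    (am bm : ℝ) (ham : am = BDP.mean a₁ T₁) (hbm : bm = BDP.mean b₁ T₂)
    -- the arrival function has positive mean, unless there are no arrivals at all
    (ham_pos : 0 < am ∨ ∀ᵐ t ∂(volume.restrict (Set.Ici (0 : ℝ))), a t = 0)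
    -- the time-dependent intensities
    (birth death : ℕ → ℝ → ℝ)
    (hbirth : birth = fun n t => lam n * a t) (hdeath : death = fun n t => mu n * b t)
    -- the process
    {Ω : Type*} [MeasurableSpace Ω] (P : Measure Ω) [IsProbabilityMeasure P] (X : ℝ → Ω → ℕ)
    (hX : BDP.IsBirthDeathProcess P N birth death X)
    (hX0 : P {ω | X 0 ω = 0} ≠ 0)
    -- the conditions, and the decay rate `l(t)` with its mean `l`
    (Δ c : ℝ) (hcond : BDP.Conditions N lam mu lamL muL am bm Δ c)
    (lfun : ℝ → ℝ) (hlfun : lfun = fun t => c * (muL * b t - Δ * lamL * a t))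
    (l : ℝ) (hl : l = c * (muL * bm - Δ * lamL * am)) :
    (∃ δ : ℕ → ℝ, BDP.IsWeight N birth death lfun δ) ∧
    ∀ ε : ℝ, 0 < ε → ε < l → ∃ K : ℝ, 0 < K ∧
      ∀ δ : ℕ → ℝ, BDP.IsWeight N birth death lfun δ →
        ∀ t : ℝ, 0 ≤ t → ∀ j : ℕ, (j : ℕ∞) < N →
          1 - (BDP.qWeight δ (j + 1))⁻¹ * K * lam 0 * am *
              (1 + Real.exp ((l - ε) * T₁) / (Real.exp ((l - ε) * T₁) - 1))
            ≤ (ProbabilityTheory.cond P {ω | X 0 ω = 0}).real {ω | X t ω ≤ j} := by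
  obtain ⟨hL, hM⟩ := hrates.limits_pos
  subst hbirth hdeath hlfun
  refine ⟨BDP.exists_isWeight hrates ha.nonneg hb.nonneg hcond, fun ε _ hεl => ?_⟩
  obtain ⟨p, hp, hcp⟩ := hX.exists_cond_eq hX0
  have hai : ∀ t, 0 ≤ t → IntervalIntegrable a volume 0 t := fun t ht =>
    ha.intervalIntegrable le_rfl ht
  have hbi : ∀ t, 0 ≤ t → IntervalIntegrable b volume 0 t := fun t ht =>
    hb.intervalIntegrable le_rfl ht
  have hs := hp.isSurvival hrates.mu_zero hai hbi
  have hT := ha.period_pos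
  have hlam0 : 0 < lam 0 := hrates.lam_pos 0 (one_pos.trans_le hrates.one_le)
  by_cases h0 : ∀ᵐ t ∂(volume.restrict (Set.Ici (0 : ℝ))), a t = 0
  · have hIa : ∀ t, 0 ≤ t → ∫ u in (0 : ℝ)..t, a u = 0 := fun t ht => by
      rw [intervalIntegral.integral_of_le ht]
      exact integral_eq_zero_of_ae (ae_restrict_of_ae_restrict_of_subset
        (fun u hu => hu.1.le) h0)
    refine ⟨1, one_pos, fun δ hδ t ht j hj => ?_⟩
    rw [ham, ha.mean_eq_zero h0, hcp t ht j hj.le, mul_zero, zero_mul]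
    -- Without arrivals `s_{j+1} ≤ s_1 ≤ λ_0 ∫ a = 0`, and since `a_m = 0` the claim is that the
    -- probability is at least `1`.
    have h1 : BDP.survival p (j + 1) t ≤ BDP.survival p 1 t := hs.antitone ht (by omega)
    have h2 := hs.le_pow_div_factorial (fun k hk => (hrates.lam_pos k hk).le)
      (fun k hk => (hrates.mu_pos (k + 1) (by omega)
        (by exact_mod_cast Order.add_one_le_of_lt hk)).le) ha.nonneg hb.nonneg hai hbi 1
      (by exact_mod_cast hrates.one_le) (Λ := lam 0) (by simp) ht
    rw [hIa t ht] at h2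
    norm_num at h2
    linarith
  have ham0 : 0 < am := ham_pos.resolve_right h0
  have hapos : ∃ t, 0 ≤ t ∧ 0 < a t := by
    by_contra! hcon
    exact h0 ((ae_restrict_mem measurableSet_Ici).mono fun t ht =>
      le_antisymm (hcon t ht) (ha.nonneg t ht))
  have hc := hcond.c_pos
  have hΔ : 0 < Δ := one_pos.trans hcond.one_lt_Δ
  obtain ⟨C, hC, hCt⟩ := BDP.exists_integral_exp_le ha hb (x := c * muL) (y := c * (Δ * lamL))
    (by positivity) (by positivity) (by
      rw [← ham, ← hbm]
      have := mul_pos hc hcond.drift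
      linarith)
  have hexp : 1 < Real.exp ((l - ε) * T₁) := Real.one_lt_exp_iff.2 (mul_pos (by linarith) hT)
  set W := 1 + Real.exp ((l - ε) * T₁) / (Real.exp ((l - ε) * T₁) - 1) with hW
  have hW0 : 0 < W := by
    have : 0 < Real.exp ((l - ε) * T₁) - 1 := by linarith
    positivity
  -- The factor `a_m W` of the stated bound is a positive constant independent of `δ`, `t` and `j`;
  -- dividing by it leaves exactly `λ_0 C / q_{j+1}`.
  refine ⟨C / (am * W), by positivity, fun δ hδ t ht j hj => ?_⟩
  have hl' : (fun t => c * (muL * b t - Δ * lamL * a t)) =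
      fun t => c * muL * b t - c * (Δ * lamL) * a t := by
    ext t
    ring
  rw [hl'] at hδ
  have h1 := (hs.qWeight_mul_le_integral hrates ha.nonneg hb.nonneg hai hbi (fun t ht =>
    ((hbi t ht).const_mul _).sub ((hai t ht).const_mul _)) hapos hδ hj ht).trans
    (mul_le_mul_of_nonneg_left (hCt t ht) hlam0.le)
  have hq : 0 < BDP.qWeight δ (j + 1) := Finset.sum_pos (fun k hk => BDP.dWeight_pos
    fun i h1 h2 => hδ.pos i h1 (lt_of_le_of_lt (by
      rw [Finset.mem_range] at hk
      exact_mod_cast (by omega : i ≤ j)) hj)) (by simp)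
  rw [hcp t ht j hj.le]
  have h2 : BDP.survival p (j + 1) t ≤ (BDP.qWeight δ (j + 1))⁻¹ * (lam 0 * C) := by
    rw [← div_eq_inv_mul, le_div_iff₀ hq]
    linarith
  have h3 : (BDP.qWeight δ (j + 1))⁻¹ * (C / (am * W)) * lam 0 * am * W =
      (BDP.qWeight δ (j + 1))⁻¹ * (lam 0 * C) := by
    field_simp
  rw [h3]
  linarith
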